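/- Consider the planar cubic differential system \[ \dot x=-y+p_2(x,y)+x\,r_2(x,y),\qquad \dot y=x+q_2(x,y)+y\,r_2(x,y),\tag{1.2} \] where $p_2=a_{20}x^2+a_{11}xy+a_{02}y^2$, $q_2=b_{20}x^2+b_{11}xy+b_{02}y^2$, $r_2=r_{20}x^2+r_{11}xy+r_{02}y^2$ and all nine parameters are real. An equilibrium is called a \emph{center} if every solution starting at another point of some neighbourhood of it is a nonconstant periodic solution, and an \emph{isochronous center} if moreover all these solutions, in some neighbourhood, have the same least period. Then, for all real values of the parameters, system (1.2) has at most two isochronous centers in $\mathbb R^2$, the origin being counted if it is one of them. More precisely, assume that $b_{02}=-b_{20}$. (I) If $a_{02}+a_{20}=a_{11}+2b_{20}=b_{11}-2a_{20}=r_{02}+r_{20}=0$, the system has at most two isochronous centers. (II) If $a_{02}=r_{02}=a_{11}+2b_{20}=b_{11}-4a_{20}=r_{11}+b_{20}^2=r_{20}-a_{20}b_{20}=0$, the system has at most one isochronous center. (III) If $4a_{02}+a_{20}=a_{11}+2b_{20}=2b_{11}-a_{20}=4r_{02}+a_{20}b_{20}=r_{11}+b_{20}^2=r_{20}-a_{20}b_{20}=0$,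 the system has at most two isochronous centers. (IV) If $a_{02}=r_{02}=a_{11}+2b_{20}=b_{11}-a_{20}=r_{20}-a_{20}b_{20}=0$, the system has at most two isochronous centers. -/

import Mathlib

open Filter Topology

/-- A real solution `γ : ℝ → ℝ × ℝ` is periodic with least period `T`. In particular `γ` is not
constant, since a constant function has arbitrarily small positive periods. -/
def HasLeastPeriod (γ : ℝ → ℝ × ℝ) (T : ℝ) : Prop :=
  0 < T ∧ (∀ t, γ (t + T) = γ t) ∧ ∀ S, 0 < S → (∀ t, γ (t + S) = γ t) → T ≤ S

/-- `p` is a center of the planar autonomous system `γ' = F γ`: an equilibrium such that all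
solutions starting at the other points of some neighbourhood of `p` are (nonconstant) periodic. -/
def IsCenter (F : ℝ × ℝ → ℝ × ℝ) (p : ℝ × ℝ) : Prop :=
  F p = 0 ∧
    ∀ᶠ q in 𝓝[≠] p, ∃ γ : ℝ → ℝ × ℝ,
      IsIntegralCurve γ (fun _ => F) ∧ γ 0 = q ∧ ∃ T, HasLeastPeriod γ T

/-- `p` is an isochronous center of `γ' = F γ`: a center such that all solutions starting at the
other points of some neighbourhood of `p` have the same (least) period. -/
def IsIsochronousCenter (F : ℝ × ℝ → ℝ × ℝ) (p : ℝ × ℝ) : Prop :=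
  IsCenter F p ∧
    ∃ T, ∀ᶠ q in 𝓝[≠] p, ∀ γ : ℝ → ℝ × ℝ,
      IsIntegralCurve γ (fun _ => F) → γ 0 = q → HasLeastPeriod γ T

/-- The real parameters of a planar cubic system
`x' = - y + p₂ + x r₂`, `y' = x + q₂ + y r₂` with `p₂, q₂, r₂` homogeneous quadratic. -/
structure CubicSystem where
  a20 : ℝ
  a11 : ℝ
  a02 : ℝ
  b20 : ℝ
  b11 : ℝ
  b02 : ℝ
  r20 : ℝ
  r11 : ℝ
  r02 : ℝ

namespace CubicSystem

def p2 (s : CubicSystem) (x y : ℝ) : ℝ := s.a20 * x ^ 2 + s.a11 * x * y + s.a02 * y ^ 2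

def q2 (s : CubicSystem) (x y : ℝ) : ℝ := s.b20 * x ^ 2 + s.b11 * x * y + s.b02 * y ^ 2

def r2 (s : CubicSystem) (x y : ℝ) : ℝ := s.r20 * x ^ 2 + s.r11 * x * y + s.r02 * y ^ 2

/-- The right-hand side `(P, Q)` of the system. -/
def field (s : CubicSystem) (z : ℝ × ℝ) : ℝ × ℝ :=
  (-z.2 + s.p2 z.1 z.2 + z.1 * s.r2 z.1 z.2, z.1 + s.q2 z.1 z.2 + z.2 * s.r2 z.1 z.2)

/-- The set of all isochronous centers of the system in the real plane. -/
def isochronousCenters (s : CubicSystem) : Set (ℝ × ℝ) :=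
  {p | IsIsochronousCenter s.field p}

/-- The four families of parameters; `b02 = -b20` is the normalization under which the
conditions are stated. -/
def CondI (s : CubicSystem) : Prop :=
  s.b02 = -s.b20 ∧ s.a02 + s.a20 = 0 ∧ s.a11 + 2 * s.b20 = 0 ∧ s.b11 - 2 * s.a20 = 0 ∧
    s.r02 + s.r20 = 0

def CondII (s : CubicSystem) : Prop :=
  s.b02 = -s.b20 ∧ s.a02 = 0 ∧ s.r02 = 0 ∧ s.a11 + 2 * s.b20 = 0 ∧ s.b11 - 4 * s.a20 = 0 ∧
    s.r11 + s.b20 ^ 2 = 0 ∧ s.r20 - s.a20 * s.b20 = 0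

def CondIII (s : CubicSystem) : Prop :=
  s.b02 = -s.b20 ∧ 4 * s.a02 + s.a20 = 0 ∧ s.a11 + 2 * s.b20 = 0 ∧ 2 * s.b11 - s.a20 = 0 ∧
    4 * s.r02 + s.a20 * s.b20 = 0 ∧ s.r11 + s.b20 ^ 2 = 0 ∧ s.r20 - s.a20 * s.b20 = 0

def CondIV (s : CubicSystem) : Prop :=
  s.b02 = -s.b20 ∧ s.a02 = 0 ∧ s.r02 = 0 ∧ s.a11 + 2 * s.b20 = 0 ∧ s.b11 - s.a20 = 0 ∧
    s.r20 - s.a20 * s.b20 = 0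

end CubicSystem

/-!
An isochronous center `p` of `γ' = F γ` with common period `T` is *rotational*: the derivative
`A = DF(p)` has no real eigenvector. Indeed the time-`T` map is the identity near `p`, so its first
variation is the identity: if `ψ` is a curve of linear functionals with `ψ' = -ψ A`, then `ψ (γ - p)`
is constant up to `o(‖γ 0 - p‖)`, whence `ψ(T) = ψ(0)` (`dual_flow_eq`). Suitable choices of `ψ` show
that in the plane a real eigenvector of `A` forces `A = 0`
(`IsIsochronousCenter.eq_zero_of_eigenvector`). But if `A = 0`, then `F` has
arbitrarily small Lipschitz constants near `p`, and nonconstant orbits of the fixed period `T` are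
impossible (`eventually_eq_zero_of_periodic`, a form of the lower bound for the period in terms of
the Lipschitz constant).

The rest is algebra. The cubic part of the system is radial, so it is invisible in the component
of the field normal to a line: for a direction `v` the function `t ↦ v × F(p + t v)` is a
polynomial of degree at most two. If it vanishes at `t = 0` and `t = 1`, its derivatives there are
opposite. Hence two equilibria without real eigenvectors rotate in opposite directions
(`rot_add_rot_eq_zero`, `Qx_mul_Qx_neg`), and three of them cannot coexist. In the family (II) the first component of the field factors as
`(1 + b x)(a x² - y (1 + b x))`; equilibria on the line `1 + b x = 0` have a vertical
eigenvector, and the origin is the only equilibrium off this line.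
-/

/-! ### Closed orbits near an equilibrium -/

section Flow

variable {E : Type*} [NormedAddCommGroup E] [NormedSpace ℝ E]

/-- Solutions starting close to an equilibrium stay close to it for a given time; no a priori
confinement of the solution is needed. -/
theorem norm_sub_le_of_isIntegralCurve {F : E → E} {p : E} {K δ T : ℝ}
    (hF : ∀ x, ‖x - p‖ ≤ δ → ‖F x‖ ≤ K * ‖x - p‖) (hK : 0 ≤ K)
    {γ : ℝ → E} (hγ : IsIntegralCurve γ (fun _ => F)) (h0 : γ 0 ≠ p)
    (hδ : ‖γ 0 - p‖ * Real.exp ((K + 1) * T) ≤ δ) {t : ℝ} (ht : t ∈ Set.Icc 0 T) :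
    ‖γ t - p‖ ≤ ‖γ 0 - p‖ * Real.exp ((K + 1) * T) := by
  have hpos : 0 < ‖γ 0 - p‖ := norm_pos_iff.mpr (sub_ne_zero.mpr h0)
  have hd : ∀ s, HasDerivAt (fun t => γ t - p) (F (γ s)) s := fun s => (hγ s).sub_const p
  have hB : ∀ s, HasDerivAt (fun t => ‖γ 0 - p‖ * Real.exp ((K + 1) * t))
      (‖γ 0 - p‖ * (Real.exp ((K + 1) * s) * ((K + 1) * 1))) s := fun s =>
    (((hasDerivAt_id s).const_mul (K + 1)).exp).const_mul _
  have hmono : ∀ s ≤ T, ‖γ 0 - p‖ * Real.exp ((K + 1) * s) ≤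
      ‖γ 0 - p‖ * Real.exp ((K + 1) * T) := fun s hs => by gcongr
  have key := image_norm_le_of_norm_deriv_right_lt_deriv_boundary
    (f := fun t => γ t - p) (f' := fun s => F (γ s)) (a := 0) (b := T)
    (fun s _ => (hd s).continuousAt.continuousWithinAt)
    (fun s _ => (hd s).hasDerivWithinAt)
    (B := fun t => ‖γ 0 - p‖ * Real.exp ((K + 1) * t)) (by simp) hB
    (fun s hs h => by
      have h1 := hmono s hs.2.le
      have h2 := hF (γ s) (by rw [h]; exact h1.trans hδ)
      rw [h] at h2
      have h3 : 0 < ‖γ 0 - p‖ * Real.exp ((K + 1) * s) := by positivity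
      calc ‖F (γ s)‖ ≤ _ := h2
        _ < _ := by linarith)
  exact (key ht).trans (hmono t ht.2)

/-- If `F p = 0` and all solutions starting near `p` return after time `T`, then the time-`T` map
of the dual linearized equation `ψ' = -ψ A`, `A = DF(p)`, is the identity. -/
theorem dual_flow_eq {F : E → E} {p : E} {A : E →L[ℝ] E} (hA : HasFDerivAt F A p)
    (hp : F p = 0) {T : ℝ} (hT : 0 < T)
    (hper : ∀ᶠ q in 𝓝[≠] p, ∃ γ : ℝ → E,
      IsIntegralCurve γ (fun _ => F) ∧ γ 0 = q ∧ γ T = q)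
    {ψ : ℝ → E →L[ℝ] ℝ} (hψ : ∀ t, HasDerivAt ψ (-(ψ t).comp A) t) : ψ T = ψ 0 := by
  ext v
  rcases eq_or_ne v 0 with rfl | hv
  · simp
  have hv' : 0 < ‖v‖ := norm_pos_iff.mpr hv
  have hψc : Continuous ψ := continuous_iff_continuousAt.mpr fun t => (hψ t).continuousAt
  obtain ⟨C, hC⟩ := (isCompact_Icc (a := (0 : ℝ)) (b := T)).exists_bound_of_continuousOn
    hψc.continuousOn
  have hC0 : 0 ≤ C := (norm_nonneg _).trans (hC 0 ⟨le_rfl, hT.le⟩)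
  set K := ‖A‖ + 1 with hK
  have hK0 : 0 ≤ K := by positivity
  set G := Real.exp ((K + 1) * T) with hG
  have hG0 : 0 < G := Real.exp_pos _
  -- The error of the linearization is at most `η ‖w‖`, with `η` arbitrarily small.
  have main : ∀ η : ℝ, 0 < η → η ≤ 1 → |ψ T v - ψ 0 v| ≤ η * (C * G * ‖v‖ * T) := by
    intro η hη hη1
    have hlo := hA.isLittleO.def hη
    obtain ⟨δ, hδ, hball⟩ := Metric.eventually_nhds_iff_ball.mp hlo
    have hball' : ∀ x, ‖x - p‖ ≤ δ / 2 → ‖F x - A (x - p)‖ ≤ η * ‖x - p‖ := fun x hx => by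
      have := hball x (by rw [mem_ball_iff_norm]; linarith)
      simpa [hp] using this
    have hFK : ∀ x, ‖x - p‖ ≤ δ / 2 → ‖F x‖ ≤ K * ‖x - p‖ := fun x hx => by
      have h1 := hball' x hx
      have h2 := A.le_opNorm (x - p)
      have h3 : ‖F x‖ ≤ ‖F x - A (x - p)‖ + ‖A (x - p)‖ := by
        simpa using norm_add_le (F x - A (x - p)) (A (x - p))
      have h4 : η * ‖x - p‖ ≤ 1 * ‖x - p‖ := by gcongr
      rw [hK]; linarith
    have htend : Tendsto (fun ε : ℝ => p + ε • v) (𝓝[>] 0) (𝓝[≠] p) := by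
      refine tendsto_nhdsWithin_iff.mpr ⟨?_, ?_⟩
      · have : Continuous (fun ε : ℝ => p + ε • v) := by fun_prop
        simpa using (this.tendsto 0).mono_left nhdsWithin_le_nhds
      · filter_upwards [self_mem_nhdsWithin] with ε (hε : 0 < ε)
        simp [hε.ne', hv]
    have hsmall : ∀ᶠ ε : ℝ in 𝓝[>] 0, ε * ‖v‖ * G ≤ δ / 2 := by
      have : Continuous (fun ε : ℝ => ε * ‖v‖ * G) := by fun_prop
      have h := (this.tendsto 0).mono_left (nhdsWithin_le_nhds (s := Set.Ioi 0))
      simp only [zero_mul] at h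
      exact h.eventually (eventually_le_nhds (half_pos hδ))
    obtain ⟨ε, ⟨⟨γ, hγ, hγ0, hγT⟩, hε⟩, hε0⟩ :=
      (((htend.eventually hper).and hsmall).and self_mem_nhdsWithin).exists
    have hε0 : 0 < ε := hε0
    have hn : ‖γ 0 - p‖ = ε * ‖v‖ := by
      rw [hγ0]; simp [norm_smul, abs_of_pos hε0]
    have hne : γ 0 ≠ p := by
      rw [← sub_ne_zero, ← norm_pos_iff, hn]; positivity
    have hst : ∀ t ∈ Set.Icc 0 T, ‖γ t - p‖ ≤ ε * ‖v‖ * G := fun t ht => by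
      have := norm_sub_le_of_isIntegralCurve hFK hK0 hγ hne (T := T) (by rw [hn]; exact hε) ht
      rwa [hn] at this
    have hg : ∀ t, HasDerivAt (fun t => ψ t (γ t - p)) (ψ t (F (γ t) - A (γ t - p))) t :=
      fun t => by
        have := (hψ t).clm_apply ((hγ t).sub_const p)
        refine this.congr_deriv ?_
        simp only [neg_apply, ContinuousLinearMap.comp_apply, map_sub]
        ring
    have hb := norm_image_sub_le_of_norm_deriv_le_segment'
      (f := fun t => ψ t (γ t - p)) (a := 0) (b := T) (C := C * (η * (ε * ‖v‖ * G)))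
      (fun t _ => (hg t).hasDerivWithinAt)
      (fun t ht => by
        have ht' := Set.Ico_subset_Icc_self ht
        refine (ContinuousLinearMap.le_opNorm _ _).trans ?_
        have h1 := hst t ht'
        have h2 := hball' (γ t) (h1.trans hε)
        have h3 : ‖F (γ t) - A (γ t - p)‖ ≤ η * (ε * ‖v‖ * G) := h2.trans (by gcongr)
        exact mul_le_mul (hC t ht') h3 (norm_nonneg _) hC0)
      T ⟨hT.le, le_rfl⟩
    have he : ψ T (γ T - p) - ψ 0 (γ 0 - p) = ε * (ψ T v - ψ 0 v) := by
      rw [hγT, hγ0]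
      simp only [add_sub_cancel_left, map_smul, smul_eq_mul]
      ring
    rw [he, Real.norm_eq_abs, abs_mul, abs_of_pos hε0] at hb
    refine le_of_mul_le_mul_left (hb.trans_eq ?_) hε0
    ring
  have hlim : Tendsto (fun η : ℝ => η * (C * G * ‖v‖ * T)) (𝓝[>] 0) (𝓝 0) := by
    have : Continuous (fun η : ℝ => η * (C * G * ‖v‖ * T)) := by fun_prop
    simpa using (this.tendsto 0).mono_left (nhdsWithin_le_nhds (s := Set.Ioi 0))
  have hle : |ψ T v - ψ 0 v| ≤ 0 := by
    refine ge_of_tendsto hlim ?_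
    filter_upwards [Ioc_mem_nhdsGT (zero_lt_one' ℝ)] with η hη using main η hη.1 hη.2
  exact sub_eq_zero.mp (abs_nonpos_iff.mp hle)

theorem eigenvalue_eq_zero_of_periodic {F : E → E} {p : E} {A : E →L[ℝ] E}
    (hA : HasFDerivAt F A p) (hp : F p = 0) {T : ℝ} (hT : 0 < T)
    (hper : ∀ᶠ q in 𝓝[≠] p, ∃ γ : ℝ → E,
      IsIntegralCurve γ (fun _ => F) ∧ γ 0 = q ∧ γ T = q)
    {l : E →L[ℝ] ℝ} (hl : l ≠ 0) {k : ℝ} (hk : l.comp A = k • l) : k = 0 := by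
  have h := dual_flow_eq hA hp hT hper (ψ := fun t => Real.exp (-k * t) • l) (fun t => by
    have h1 : HasDerivAt (fun t => Real.exp (-k * t)) (Real.exp (-k * t) * (-k * 1)) t :=
      ((hasDerivAt_id t).const_mul (-k)).exp
    refine (h1.smul_const l).congr_deriv ?_
    rw [ContinuousLinearMap.smul_comp, hk, smul_smul]
    module)
  simp only [mul_zero, Real.exp_zero] at h
  have h2 := smul_left_injective ℝ hl h
  rw [Real.exp_eq_one_iff] at h2
  rcases mul_eq_zero.mp h2 with h3 | h3
  · linarith
  · exact absurd h3 hT.ne'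

theorem comp_eq_zero_of_periodic {F : E → E} {p : E} {A : E →L[ℝ] E}
    (hA : HasFDerivAt F A p) (hp : F p = 0) {T : ℝ} (hT : 0 < T)
    (hper : ∀ᶠ q in 𝓝[≠] p, ∃ γ : ℝ → E,
      IsIntegralCurve γ (fun _ => F) ∧ γ 0 = q ∧ γ T = q)
    {l : E →L[ℝ] ℝ} (hl : (l.comp A).comp A = 0) : l.comp A = 0 := by
  have h := dual_flow_eq hA hp hT hper (ψ := fun t => l - t • l.comp A) (fun t => by
    refine (((hasDerivAt_id t).smul_const (l.comp A)).const_sub l).congr_deriv ?_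
    rw [ContinuousLinearMap.sub_comp, ContinuousLinearMap.smul_comp, hl]
    simp)
  simp only [zero_smul, sub_zero, sub_eq_self] at h
  exact (smul_eq_zero.mp h).resolve_left hT.ne'

end Flow

/-- Near an equilibrium with vanishing derivative, a planar field whose solutions all return
after a fixed time is identically zero. -/
theorem eventually_eq_zero_of_periodic {F : ℝ × ℝ → ℝ × ℝ} {p : ℝ × ℝ}
    (hA : HasStrictFDerivAt F (0 : ℝ × ℝ →L[ℝ] ℝ × ℝ) p) (hp : F p = 0) {T : ℝ} (hT : 0 < T)
    (hper : ∀ᶠ q in 𝓝[≠] p, ∃ γ : ℝ → ℝ × ℝ,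
      IsIntegralCurve γ (fun _ => F) ∧ γ 0 = q ∧ γ T = q) :
    ∀ᶠ q in 𝓝[≠] p, F q = 0 := by
  set c := 1 / (2 * T) with hc
  have hc0 : 0 < c := by positivity
  have hcT : c * T = 1 / 2 := by rw [hc]; field_simp
  obtain ⟨δ, hδ, hball⟩ := Metric.eventually_nhds_iff_ball.mp (hA.isLittleO.def hc0)
  have hLip : ∀ x y, ‖x - p‖ ≤ δ / 2 → ‖y - p‖ ≤ δ / 2 → ‖F x - F y‖ ≤ c * ‖x - y‖ := by
    intro x y hx hy
    have := hball (x, y) (by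
      rw [mem_ball_iff_norm, Prod.norm_def]
      exact max_lt (by simp only [Prod.fst_sub]; linarith) (by simp only [Prod.snd_sub]; linarith))
    simpa using this
  have hF : ∀ x, ‖x - p‖ ≤ δ / 2 → ‖F x‖ ≤ c * ‖x - p‖ := fun x hx => by
    simpa [hp] using hLip x p hx (by simpa using (half_pos hδ).le)
  have hsmall : ∀ᶠ q in 𝓝[≠] p, ‖q - p‖ * Real.exp ((c + 1) * T) ≤ δ / 2 := by
    have : Continuous (fun q : ℝ × ℝ => ‖q - p‖ * Real.exp ((c + 1) * T)) := by fun_prop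
    have h := (this.tendsto p).mono_left (nhdsWithin_le_nhds (s := {p}ᶜ))
    simp only [sub_self, norm_zero, zero_mul] at h
    exact h.eventually (eventually_le_nhds (half_pos hδ))
  filter_upwards [hper, hsmall, self_mem_nhdsWithin] with q ⟨γ, hγ, hγ0, hγT⟩ hq hqp
  have hst : ∀ t ∈ Set.Icc 0 T, ‖γ t - p‖ ≤ δ / 2 := fun t ht =>
    (norm_sub_le_of_isIntegralCurve hF hc0.le hγ (by rw [hγ0]; exact hqp)
      (by rw [hγ0]; exact hq) ht).trans (by rw [hγ0]; exact hq)
  have hγc : Continuous γ := continuous_iff_continuousAt.mpr fun t => (hγ t).continuousAt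
  have hFc : ContinuousOn (fun t => ‖F (γ t)‖) (Set.Icc 0 T) := by
    refine ContinuousOn.norm (Metric.continuousOn_iff.mpr fun t ht ε hε => ?_)
    obtain ⟨r, hr, hr'⟩ := Metric.continuous_iff.mp hγc t (ε / c) (by positivity)
    refine ⟨r, hr, fun s hs hst' => ?_⟩
    rw [dist_eq_norm]
    have h1 := hr' s hst'
    rw [dist_eq_norm, lt_div_iff₀ hc0] at h1
    exact (hLip _ _ (hst s hs) (hst t ht)).trans_lt (by linarith)
  obtain ⟨m, hm, hmax⟩ := isCompact_Icc.exists_isMaxOn (Set.nonempty_Icc.mpr hT.le) hFc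
  set M := ‖F (γ m)‖ with hM
  have hMb : ∀ t ∈ Set.Icc 0 T, ‖F (γ t)‖ ≤ M := fun t ht => hmax ht
  have hvar : ∀ t ∈ Set.Icc 0 T, ∀ s ∈ Set.Icc 0 T, ‖F (γ t) - F (γ s)‖ ≤ M / 2 := by
    intro t ht s hs
    refine (hLip _ _ (hst t ht) (hst s hs)).trans ?_
    have h1 := (convex_Icc (0 : ℝ) T).norm_image_sub_le_of_norm_hasDerivWithin_le
      (fun u _ => (hγ u).hasDerivWithinAt) hMb hs ht
    have h2 : ‖t - s‖ ≤ T := by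
      rw [Real.norm_eq_abs, abs_le]; constructor <;> linarith [ht.1, ht.2, hs.1, hs.2]
    have hM0 : 0 ≤ M := norm_nonneg _
    calc c * ‖γ t - γ s‖ ≤ c * (M * T) := by gcongr; exact h1.trans (by gcongr)
      _ = M / 2 := by linear_combination M * hcT
  -- By Rolle, each component of the velocity vanishes somewhere on a closed orbit.
  obtain ⟨c1, hc1, hz1⟩ := exists_hasDerivAt_eq_zero (f := fun t => (γ t).1)
    (f' := fun t => (F (γ t)).1) hT (by fun_prop) (by simp [hγ0, hγT])
    (fun t _ => ((hasFDerivAt_fst (𝕜 := ℝ) (p := γ t)).comp_hasDerivAt t (hγ t)))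
  obtain ⟨c2, hc2, hz2⟩ := exists_hasDerivAt_eq_zero (f := fun t => (γ t).2)
    (f' := fun t => (F (γ t)).2) hT (by fun_prop) (by simp [hγ0, hγT])
    (fun t _ => ((hasFDerivAt_snd (𝕜 := ℝ) (p := γ t)).comp_hasDerivAt t (hγ t)))
  have hMle : M ≤ M / 2 := by
    rw [hM, Prod.norm_def]
    refine max_le ?_ ?_
    · have h1 := (norm_fst_le _).trans (hvar m hm c1 (Set.Ioo_subset_Icc_self hc1))
      rwa [Prod.fst_sub, hz1, sub_zero] at h1
    · have h1 := (norm_snd_le _).trans (hvar m hm c2 (Set.Ioo_subset_Icc_self hc2))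
      rwa [Prod.snd_sub, hz2, sub_zero] at h1
  have h0 := hMb 0 ⟨le_rfl, hT.le⟩
  rw [hγ0] at h0
  exact norm_le_zero_iff.mp (by linarith)

/-! ### The linear part at an isochronous center -/

theorem IsIsochronousCenter.exists_common_period {F : ℝ × ℝ → ℝ × ℝ} {p : ℝ × ℝ}
    (h : IsIsochronousCenter F p) : ∃ T, 0 < T ∧
      (∀ᶠ q in 𝓝[≠] p, ∃ γ : ℝ → ℝ × ℝ,
        IsIntegralCurve γ (fun _ => F) ∧ γ 0 = q ∧ γ T = q) ∧
      ∀ᶠ q in 𝓝[≠] p, F q ≠ 0 := by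
  obtain ⟨⟨-, h1⟩, T, h2⟩ := h
  obtain ⟨q, ⟨γ, hγ, hγ0, -⟩, hq⟩ := (h1.and h2).exists
  refine ⟨T, (hq γ hγ hγ0).1, ?_, ?_⟩
  · filter_upwards [h1, h2] with q ⟨γ, hγ, hγ0, _⟩ hq
    refine ⟨γ, hγ, hγ0, ?_⟩
    simpa [hγ0] using (hq γ hγ hγ0).2.1 0
  · filter_upwards [h2] with q hq hF
    -- A constant solution has no least period.
    obtain ⟨hT, -, hmin⟩ := hq (fun _ => q)
      (fun t => by simpa [hF] using hasDerivAt_const t q) rfl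
    linarith [hmin (T / 2) (half_pos hT) fun _ => rfl]

/-- The derivative of a planar field at an isochronous center has no real eigenvector. -/
theorem IsIsochronousCenter.eq_zero_of_eigenvector {F : ℝ × ℝ → ℝ × ℝ} {p : ℝ × ℝ}
    (h : IsIsochronousCenter F p) {A : ℝ × ℝ →L[ℝ] ℝ × ℝ} (hA : HasStrictFDerivAt F A p)
    {v : ℝ × ℝ} (hv : v.1 * (A v).2 - v.2 * (A v).1 = 0) : v = 0 := by
  by_contra hv0
  obtain ⟨T, hT, hper, hne⟩ := h.exists_common_period
  have hp := h.1.1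
  suffices hz : A = 0 by
    subst hz
    obtain ⟨q, h1, h2⟩ := ((eventually_eq_zero_of_periodic hA hp hT hper).and hne).exists
    exact h2 h1
  have hN : 0 < v.1 ^ 2 + v.2 ^ 2 := by
    rcases eq_or_ne v.1 0 with h1 | h1
    · have h2 : v.2 ≠ 0 := fun h2 => hv0 (Prod.ext h1 h2)
      positivity
    · positivity
  set a := (A (1, 0)).1 with ha
  set c := (A (1, 0)).2 with hcc
  set b := (A (0, 1)).1 with hb
  set d := (A (0, 1)).2 with hd
  have hAw : ∀ w : ℝ × ℝ, A w = (a * w.1 + b * w.2, c * w.1 + d * w.2) := fun w => by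
    have : w = w.1 • ((1, 0) : ℝ × ℝ) + w.2 • ((0, 1) : ℝ × ℝ) := by ext <;> simp
    conv_lhs => rw [this, map_add, map_smul, map_smul]
    ext <;> simp [ha, hb, hcc, hd, mul_comm]
  -- `l w = v × w` is an eigenvector of the dual map, its eigenvalue is the second one of `A`.
  set l : ℝ × ℝ →L[ℝ] ℝ :=
    v.1 • ContinuousLinearMap.snd ℝ ℝ ℝ - v.2 • ContinuousLinearMap.fst ℝ ℝ ℝ with hl
  have hlw : ∀ w, l w = v.1 * w.2 - v.2 * w.1 := fun w => by simp [hl]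
  have hl0 : l ≠ 0 := fun h0 => by
    have h1 : l (-v.2, v.1) = 0 := by rw [h0]; rfl
    rw [hlw] at h1
    simp only at h1
    nlinarith
  simp only [hAw] at hv
  set N := v.1 ^ 2 + v.2 ^ 2 with hNdef
  set j : ℝ := (v.1 * (-c * v.2 + d * v.1) - v.2 * (-a * v.2 + b * v.1)) / N with hj
  have hj0 : j = 0 := by
    refine eigenvalue_eq_zero_of_periodic hA.hasFDerivAt hp hT hper hl0 ?_
    ext
    all_goals
      simp only [ContinuousLinearMap.comp_apply, hAw, hlw, ContinuousLinearMap.inl_apply,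
        ContinuousLinearMap.inr_apply, smul_apply, smul_eq_mul]
      rw [hj]; field_simp; rw [hNdef]
    · linear_combination v.1 * hv
    · linear_combination v.2 * hv
  -- Hence the range of `A` is contained in the line of `v`.
  have hjN : v.1 * (-c * v.2 + d * v.1) - v.2 * (-a * v.2 + b * v.1) = 0 :=
    (div_eq_zero_iff.mp (hj ▸ hj0)).resolve_right hN.ne'
  have hr1 : v.1 * c - v.2 * a = 0 := by
    refine (mul_eq_zero.mp (?_ : N * (v.1 * c - v.2 * a) = 0)).resolve_left hN.ne'
    linear_combination v.1 * hv - v.2 * hjN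
  have hr2 : v.1 * d - v.2 * b = 0 := by
    refine (mul_eq_zero.mp (?_ : N * (v.1 * d - v.2 * b) = 0)).resolve_left hN.ne'
    linear_combination v.2 * hv + v.1 * hjN
  have hd1 : v.1 * (b * c - a * d) = 0 := by linear_combination b * hr1 - a * hr2
  have hd2 : v.2 * (b * c - a * d) = 0 := by linear_combination d * hr1 - c * hr2
  set m : ℝ × ℝ →L[ℝ] ℝ :=
    v.1 • ContinuousLinearMap.fst ℝ ℝ ℝ + v.2 • ContinuousLinearMap.snd ℝ ℝ ℝ with hm
  have hmw : ∀ w, m w = v.1 * w.1 + v.2 * w.2 := fun w => by simp [hm]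
  have hmA : (m.comp A).comp A = (a + d) • m.comp A := by
    ext
    all_goals
      simp only [ContinuousLinearMap.comp_apply, hAw, hmw, ContinuousLinearMap.inl_apply,
        ContinuousLinearMap.inr_apply, smul_apply, smul_eq_mul]
    · linear_combination hd1
    · linear_combination hd2
  have hm0 : m.comp A = 0 := by
    by_contra h0
    have htr := eigenvalue_eq_zero_of_periodic hA.hasFDerivAt hp hT hper h0 hmA
    refine h0 (comp_eq_zero_of_periodic hA.hasFDerivAt hp hT hper ?_)
    rw [hmA, htr, zero_smul]
  have hs1 : v.1 * a + v.2 * c = 0 := by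
    have : m (A (1, 0)) = 0 := by rw [← ContinuousLinearMap.comp_apply, hm0]; rfl
    rwa [hmw] at this
  have hs2 : v.1 * b + v.2 * d = 0 := by
    have : m (A (0, 1)) = 0 := by rw [← ContinuousLinearMap.comp_apply, hm0]; rfl
    rwa [hmw] at this
  have hz : ∀ x y : ℝ, v.1 * x + v.2 * y = 0 → v.1 * y - v.2 * x = 0 → x = 0 ∧ y = 0 :=
    fun x y h1 h2 =>
      ⟨(mul_eq_zero.mp (by linear_combination v.1 * h1 - v.2 * h2 : N * x = 0)).resolve_left hN.ne',
       (mul_eq_zero.mp (by linear_combination v.2 * h1 + v.1 * h2 : N * y = 0)).resolve_left hN.ne'⟩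
  obtain ⟨ha0, hc0⟩ := hz a c hs1 hr1
  obtain ⟨hb0, hd0⟩ := hz b d hs2 hr2
  ext <;> simp [hAw, ha0, hb0, hc0, hd0]

/-! ### Binary quadratic forms without real zeros -/

/-- A real binary quadratic form without nontrivial zeros has the sign of its leading
coefficient everywhere. -/
theorem mul_quadForm_pos {α β γ : ℝ}
    (h : ∀ x y : ℝ, α * x ^ 2 + β * x * y + γ * y ^ 2 = 0 → x = 0 ∧ y = 0)
    {x y : ℝ} (hxy : x ≠ 0 ∨ y ≠ 0) : 0 < α * (α * x ^ 2 + β * x * y + γ * y ^ 2) := by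
  have hα : α ≠ 0 := fun h0 => one_ne_zero (h 1 0 (by simp [h0])).1
  have hD : β ^ 2 - 4 * α * γ < 0 := by
    by_contra! hD
    have hs := Real.sq_sqrt hD
    have := (h (-β + √(β ^ 2 - 4 * α * γ)) (2 * α) (by linear_combination α * hs)).2
    exact hα (by linarith)
  have h4 : 4 * (α * (α * x ^ 2 + β * x * y + γ * y ^ 2)) =
      (2 * α * x + β * y) ^ 2 + (4 * α * γ - β ^ 2) * y ^ 2 := by ring
  rcases eq_or_ne y 0 with rfl | hy
  · have hx : x ≠ 0 := by simpa using hxy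
    have : 0 < (α * x) ^ 2 := by positivity
    linarith
  · have : 0 < (4 * α * γ - β ^ 2) * y ^ 2 := mul_pos (by linarith) (by positivity)
    nlinarith [sq_nonneg (2 * α * x + β * y)]

/-! ### Equilibria of the cubic system -/

namespace CubicSystem

/-- Partial derivative `∂P/∂x` of the first component of the field. -/
def Px (s : CubicSystem) (p : ℝ × ℝ) : ℝ :=
  2 * s.a20 * p.1 + s.a11 * p.2 + s.r2 p.1 p.2 + p.1 * (2 * s.r20 * p.1 + s.r11 * p.2)

/-- Partial derivative `∂P/∂y` of the first component of the field. -/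
def Py (s : CubicSystem) (p : ℝ × ℝ) : ℝ :=
  -1 + s.a11 * p.1 + 2 * s.a02 * p.2 + p.1 * (s.r11 * p.1 + 2 * s.r02 * p.2)

/-- Partial derivative `∂Q/∂x` of the second component of the field. -/
def Qx (s : CubicSystem) (p : ℝ × ℝ) : ℝ :=
  1 + 2 * s.b20 * p.1 + s.b11 * p.2 + p.2 * (2 * s.r20 * p.1 + s.r11 * p.2)

/-- Partial derivative `∂Q/∂y` of the second component of the field. -/
def Qy (s : CubicSystem) (p : ℝ × ℝ) : ℝ :=
  s.b11 * p.1 + 2 * s.b02 * p.2 + s.r2 p.1 p.2 + p.2 * (s.r11 * p.1 + 2 * s.r02 * p.2)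

theorem exists_hasStrictFDerivAt_field (s : CubicSystem) (p : ℝ × ℝ) :
    ∃ A : ℝ × ℝ →L[ℝ] ℝ × ℝ, HasStrictFDerivAt s.field A p ∧
      ∀ w, A w = (s.Px p * w.1 + s.Py p * w.2, s.Qx p * w.1 + s.Qy p * w.2) := by
  have hx : HasStrictFDerivAt (fun z : ℝ × ℝ => z.1) (ContinuousLinearMap.fst ℝ ℝ ℝ) p :=
    hasStrictFDerivAt_fst
  have hy : HasStrictFDerivAt (fun z : ℝ × ℝ => z.2) (ContinuousLinearMap.snd ℝ ℝ ℝ) p :=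
    hasStrictFDerivAt_snd
  have hq (a b c : ℝ) := (((hx.pow 2).const_mul a).add ((hx.const_mul b).mul hy)).add
    ((hy.pow 2).const_mul c)
  have hr := hq s.r20 s.r11 s.r02
  have h := (hy.neg.add (hq s.a20 s.a11 s.a02) |>.add (hx.mul hr)).prodMk
    (hx.add (hq s.b20 s.b11 s.b02) |>.add (hy.mul hr))
  refine ⟨_, h, fun w => ?_⟩
  ext
  all_goals
    simp [Px, Py, Qx, Qy, r2]
    ring

/-- The quadratic form `v ↦ v × DF(p) v`; its sign is the sense of rotation around `p`. -/
def rot (s : CubicSystem) (p v : ℝ × ℝ) : ℝ :=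
  s.Qx p * v.1 ^ 2 + (s.Qy p - s.Px p) * v.1 * v.2 + -s.Py p * v.2 ^ 2

theorem eq_zero_of_rot_eq_zero (s : CubicSystem) {p : ℝ × ℝ} (hp : p ∈ s.isochronousCenters)
    {v : ℝ × ℝ} (hv : s.rot p v = 0) : v = 0 := by
  obtain ⟨A, hA, hAw⟩ := s.exists_hasStrictFDerivAt_field p
  refine IsIsochronousCenter.eq_zero_of_eigenvector hp hA ?_
  rw [hAw]
  simp only [rot] at hv
  linear_combination hv

theorem field_eq_zero (s : CubicSystem) {p : ℝ × ℝ} (hp : p ∈ s.isochronousCenters) :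
    s.field p = 0 := hp.1.1

/-- The normal component `N` of the field along the line through `p` and `q` is a polynomial of
degree at most two, so that `N'(0) + N'(1) = 2 (N(1) - N(0))`; here `N(0) = N(1) = 0`. -/
theorem rot_add_rot_eq_zero (s : CubicSystem) {p q : ℝ × ℝ} (hp : s.field p = 0)
    (hq : s.field q = 0) : s.rot p (q - p) + s.rot q (q - p) = 0 := by
  simp only [field, Prod.mk_eq_zero] at hp hq
  simp only [rot, Px, Py, Qx, Qy, Prod.fst_sub, Prod.snd_sub, p2, q2, r2] at hp hq ⊢
  linear_combination 2 * (q.1 - p.1) * (hq.2 - hp.2) - 2 * (q.2 - p.2) * (hq.1 - hp.1)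

theorem Qx_mul_rot_pos (s : CubicSystem) {p : ℝ × ℝ} (hp : p ∈ s.isochronousCenters)
    {v : ℝ × ℝ} (hv : v ≠ 0) : 0 < s.Qx p * s.rot p v := by
  refine mul_quadForm_pos (fun x y h => ?_) ?_
  · exact Prod.mk_eq_zero.mp (s.eq_zero_of_rot_eq_zero hp (v := (x, y)) h)
  · by_contra! h
    exact hv (Prod.ext h.1 h.2)

/-- Two isochronous centers rotate in opposite directions. -/
theorem Qx_mul_Qx_neg (s : CubicSystem) {p q : ℝ × ℝ} (hp : p ∈ s.isochronousCenters)
    (hq : q ∈ s.isochronousCenters) (hpq : p ≠ q) : s.Qx p * s.Qx q < 0 := by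
  have hv : q - p ≠ 0 := sub_ne_zero.mpr hpq.symm
  have h := mul_pos (s.Qx_mul_rot_pos hp hv) (s.Qx_mul_rot_pos hq hv)
  have he := s.rot_add_rot_eq_zero (s.field_eq_zero hp) (s.field_eq_zero hq)
  rw [eq_neg_of_add_eq_zero_right he] at h
  by_contra! hn
  nlinarith [mul_nonneg hn (sq_nonneg (s.rot p (q - p)))]

theorem encard_isochronousCenters_le_two (s : CubicSystem) :
    s.isochronousCenters.encard ≤ 2 := by
  by_contra! hlt
  obtain ⟨t, ht, hcard⟩ := Set.exists_subset_encard_eq (Order.add_one_le_of_lt hlt)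
  obtain ⟨p, q, r, hpq, hpr, hqr, rfl⟩ := Set.encard_eq_three.mp (hcard.trans (by norm_num))
  have hp := ht (by simp : p ∈ _)
  have hq := ht (by simp : q ∈ _)
  have hr := ht (by simp : r ∈ _)
  have h1 := s.Qx_mul_Qx_neg hp hq hpq
  have h2 := s.Qx_mul_Qx_neg hp hr hpr
  have h3 := s.Qx_mul_Qx_neg hq hr hqr
  nlinarith [mul_pos_of_neg_of_neg h1 h2, sq_nonneg (s.Qx p)]

theorem CondII.eq_zero_of_mem {s : CubicSystem} (h : s.CondII) {p : ℝ × ℝ}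
    (hp : p ∈ s.isochronousCenters) : p = 0 := by
  obtain ⟨h1, h2, h3, h4, h5, h6, h7⟩ := h
  obtain ⟨hP, hQ⟩ := Prod.mk_eq_zero.mp (s.field_eq_zero hp)
  simp only [p2, q2, r2] at hP hQ
  obtain ⟨x, y⟩ := p
  replace h4 := eq_neg_of_add_eq_zero_left h4
  replace h5 := sub_eq_zero.mp h5
  replace h6 := eq_neg_of_add_eq_zero_left h6
  replace h7 := sub_eq_zero.mp h7
  simp only [h1, h2, h3, h4, h5, h6, h7] at hP hQ
  by_cases hu : 1 + s.b20 * x = 0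
  · -- The line `1 + b₂₀ x = 0` is invariant, and its direction is an eigenvector.
    have : s.rot (x, y) (0, 1) = 0 := by
      simp only [rot, Py, h2, h3, h4, h6]
      linear_combination (1 + s.b20 * x) * hu
    simpa using s.eq_zero_of_rot_eq_zero hp this
  have hy : s.a20 * x ^ 2 - y * (1 + s.b20 * x) = 0 :=
    (mul_eq_zero.mp (by linear_combination hP :
      (1 + s.b20 * x) * (s.a20 * x ^ 2 - y * (1 + s.b20 * x)) = 0)).resolve_left hu
  have hx : x * ((1 + s.b20 * x) ^ 2 + 4 * (s.a20 * x) ^ 2) = 0 := by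
    linear_combination (1 + s.b20 * x) * hQ +
      (4 * s.a20 * x - s.b20 * y * (1 + s.b20 * x)) * hy
  have hpos : 0 < (1 + s.b20 * x) ^ 2 + 4 * (s.a20 * x) ^ 2 := by positivity
  have hx0 : x = 0 := (mul_eq_zero.mp hx).resolve_right hpos.ne'
  subst hx0
  have hy0 : y = 0 := by linarith
  rw [hy0]; rfl

end CubicSystem

theorem theorem3 (s : CubicSystem) :
    s.isochronousCenters.encard ≤ 2 ∧
    (s.CondI → s.isochronousCenters.encard ≤ 2) ∧
    (s.CondII → s.isochronousCenters.encard ≤ 1) ∧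
    (s.CondIII → s.isochronousCenters.encard ≤ 2) ∧
    (s.CondIV → s.isochronousCenters.encard ≤ 2) := by
  have h := s.encard_isochronousCenters_le_two
  refine ⟨h, fun _ => h, fun hII => ?_, fun _ => h, fun _ => h⟩
  exact Set.encard_le_one_iff.mpr fun p q hp hq =>
    (hII.eq_zero_of_mem hp).trans (hII.eq_zero_of_mem hq).symm
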